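/- Let $\mathcal F^2$ be the Fock space, that is, the Hilbert space of entire functions $f$ with $\|f\|^2=\frac1\pi\int_{\mathbb C}|f(z)|^2e^{-|z|^2}\,dV(z)<\infty$, where $V$ is Lebesgue measure on $\mathbb C$. Let $\varphi,\psi\colon\mathbb C\to\mathbb C$ be entire functions with $\psi\not\equiv0$. The maximal weighted composition operator $W_{\psi,\varphi,\max}$ is given by $W_{\psi,\varphi,\max}f=\psi\cdot(f\circ\varphi)$ on the domain $\{f\in\mathcal F^2:\psi\cdot (f\circ\varphi)\in\mathcal F^2\}$. Let $W_{\psi,\varphi}$ be an unbounded (that is, not necessarily bounded) weighted composition operator, i.e. the restriction of $W_{\psi,\varphi,\max}$ to some linear subspace of its domain. An operator $T$ is called normal if it is closed and densely defined, $\operatorname{dom}(T)=\operatorname{dom}(T^*)$, and $\|Tf\|=\|T^*f\|$ for all $f\in\operatorname{dom}(T)$. Then the following are equivalent. 1. The operator $W_{\psi,\varphi}$ is normal. 2. Both of the following hold: (a) $W_{\psi,\varphi}=W_{\psi,\varphi,\max}$ (with equality of domains); (b) one of the following cases occurs: (i) there are $A,B,C,D\in\mathbb C$ with $A\ne1$ such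 that $\varphi(z)=Az+B$ and $\psi(z)=Ce^{Dz}$ for all $z\in\mathbb C$, where $D=\overline B(1-A)(1-\overline A)^{-1}$; (ii) there are $B,C,D\in\mathbb C$ with $|D|=|B|$ such that $\varphi(z)=z+B$ and $\psi(z)=Ce^{Dz}$ for all $z\in\mathbb C$. -/

import Mathlib

open MeasureTheory Complex
open scoped ComplexConjugate ENNReal

noncomputable section

namespace FockWCO

/-- The Gaussian measure `π⁻¹ e^{-|z|²} dV(z)` on `ℂ`. -/
def gaussian : Measure ℂ :=
  volume.withDensity fun z => ENNReal.ofReal (Real.pi⁻¹ * Real.exp (-‖z‖ ^ 2))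

/-- The linear space of entire functions which are square integrable for the Gaussian measure. -/
def fockSubmodule : Submodule ℂ (ℂ → ℂ) where
  carrier := {f | Differentiable ℂ f ∧ MemLp f 2 gaussian}
  zero_mem' := ⟨differentiable_const _, MemLp.zero⟩
  add_mem' hf hg := ⟨hf.1.add hg.1, hf.2.add hg.2⟩
  smul_mem' c _ hf := ⟨hf.1.const_smul c, hf.2.const_smul c⟩

/-- The Fock space `F²`. It is a type synonym for `fockSubmodule`, so that it does not carry the
topology of pointwise convergence. -/
def Fock : Type := fockSubmodule

namespace Fock

instance : AddCommGroup Fock := inferInstanceAs (AddCommGroup fockSubmodule)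

instance : Module ℂ Fock := inferInstanceAs (Module ℂ fockSubmodule)

instance : CoeFun Fock fun _ => ℂ → ℂ := ⟨fun f => f.1⟩

@[ext] theorem ext {f g : Fock} (h : ∀ z, f z = g z) : f = g := Subtype.ext (funext h)

theorem differentiable (f : Fock) : Differentiable ℂ f := f.2.1

theorem memLp (f : Fock) : MemLp f 2 gaussian := f.2.2

/-- The class of an element of `F²` in `L²` of the Gaussian measure. -/
def toL2 : Fock →ₗ[ℂ] Lp ℂ 2 gaussian where
  toFun f := f.memLp.toLp f
  map_add' _ _ := rfl
  map_smul' _ _ := rfl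

theorem inner_toL2 (f g : Fock) :
    inner ℂ (toL2 f) (toL2 g) = ∫ z, g z * conj (f z) ∂gaussian := by
  rw [L2.inner_def]
  refine integral_congr_ae ?_
  filter_upwards [f.memLp.coeFn_toLp, g.memLp.coeFn_toLp] with z hf hg
  change inner ℂ ((f.memLp.toLp f) z) ((g.memLp.toLp g) z) = _
  rw [hf, hg]
  rfl

/-- The Gaussian measure has a density bounded
below by a positive constant on every disc. -/
theorem setLIntegral_closedBall_le (R : ℝ) (F : ℂ → ℝ≥0∞) :
    ∫⁻ w in Metric.closedBall 0 R, F w ≤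
      ENNReal.ofReal (Real.pi * Real.exp (R ^ 2)) * ∫⁻ w, F w ∂gaussian := by
  have hm : Measurable fun z : ℂ => ENNReal.ofReal (Real.pi⁻¹ * Real.exp (-‖z‖ ^ 2)) := by
    fun_prop
  rw [gaussian, lintegral_withDensity_eq_lintegral_mul_non_measurable _ hm
    (Filter.Eventually.of_forall fun z => ENNReal.ofReal_lt_top),
    ← lintegral_const_mul' _ _ ENNReal.ofReal_ne_top]
  refine le_trans (setLIntegral_mono' measurableSet_closedBall fun w hw => ?_)
    (setLIntegral_le_lintegral (Metric.closedBall 0 R) _)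
  have hw' : ‖w‖ ≤ R := by simpa using hw
  have h1 : (1 : ℝ) ≤ Real.pi * Real.exp (R ^ 2) * (Real.pi⁻¹ * Real.exp (-‖w‖ ^ 2)) := by
    have : Real.pi * Real.exp (R ^ 2) * (Real.pi⁻¹ * Real.exp (-‖w‖ ^ 2))
        = Real.exp (R ^ 2 - ‖w‖ ^ 2) := by
      rw [show R ^ 2 - ‖w‖ ^ 2 = R ^ 2 + -‖w‖ ^ 2 by ring, Real.exp_add]
      field_simp
    rw [this]
    exact Real.one_le_exp (by nlinarith [norm_nonneg w])
  rw [Pi.mul_apply, ← mul_assoc, ← ENNReal.ofReal_mul (by positivity)]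
  exact le_mul_of_one_le_left (zero_le) (by simpa using ENNReal.ofReal_le_ofReal h1)

theorem norm_sq_le_lintegral_circle {f : ℂ → ℂ} (hf : Differentiable ℂ f) (z : ℂ) (r : ℝ) :
    ENNReal.ofReal (2 * Real.pi) * ‖f z‖ₑ ^ 2 ≤
      ∫⁻ θ in Set.Ioo (-Real.pi) Real.pi, ‖f (z + Complex.polarCoord.symm (r, θ))‖ₑ ^ 2 := by
  have h1 : Real.circleAverage (fun w => f w ^ 2) z r = f z ^ 2 :=
    (hf.pow 2).diffContOnCl.circleAverage
  rw [Real.circleAverage_eq_integral_add (-Real.pi)] at h1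
  have h2 : ∫ θ in (0 : ℝ)..2 * Real.pi, f (circleMap z r (θ + -Real.pi)) ^ 2
      = ∫ θ in Set.Ioo (-Real.pi) Real.pi, f (z + Complex.polarCoord.symm (r, θ)) ^ 2 := by
    rw [intervalIntegral.integral_comp_add_right (fun θ => f (circleMap z r θ) ^ 2),
      intervalIntegral.integral_of_le (by linarith [Real.pi_pos]), integral_Ioc_eq_integral_Ioo]
    have : 2 * Real.pi + -Real.pi = Real.pi := by ring
    rw [zero_add, this]
    refine integral_congr_ae (Filter.Eventually.of_forall fun θ => ?_)
    simp [circleMap, Complex.polarCoord_symm_apply, Complex.exp_mul_I]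
  rw [h2] at h1
  have h3 : ∫ θ in Set.Ioo (-Real.pi) Real.pi, f (z + Complex.polarCoord.symm (r, θ)) ^ 2
      = ((2 * Real.pi : ℝ) : ℂ) * f z ^ 2 := by
    rw [← h1, Complex.real_smul, ← mul_assoc, ← Complex.ofReal_mul,
      mul_inv_cancel₀ (by positivity)]
    simp
  have h4 := enorm_integral_le_lintegral_enorm
    (μ := volume.restrict (Set.Ioo (-Real.pi) Real.pi))
    fun θ => f (z + Complex.polarCoord.symm (r, θ)) ^ 2
  rw [h3, enorm_mul, enorm_pow] at h4
  have h5 : ‖((2 * Real.pi : ℝ) : ℂ)‖ₑ = ENNReal.ofReal (2 * Real.pi) := by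
    rw [← ofReal_norm, Complex.norm_real, Real.norm_of_nonneg (by positivity)]
  simpa only [h5, enorm_pow] using h4

theorem norm_sq_le_lintegral_ball {f : ℂ → ℂ} (hf : Differentiable ℂ f) (z : ℂ) :
    ENNReal.ofReal Real.pi * ‖f z‖ₑ ^ 2 ≤ ∫⁻ w in Metric.closedBall z 1, ‖f w‖ₑ ^ 2 := by
  have hc : Continuous f := hf.continuous
  set G : ℂ → ℝ≥0∞ := (Metric.closedBall (0 : ℂ) 1).indicator fun w => ‖f (z + w)‖ₑ ^ 2 with hG
  have h0 : ∫⁻ w in Metric.closedBall z 1, ‖f w‖ₑ ^ 2 = ∫⁻ w, G w := by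
    rw [← lintegral_indicator measurableSet_closedBall,
      ← lintegral_add_left_eq_self _ z]
    refine lintegral_congr fun w => ?_
    by_cases hw : ‖w‖ ≤ 1 <;> simp [hG, Set.indicator, dist_eq_norm, hw]
  have hs : (Set.Ioc (0 : ℝ) 1) ×ˢ Set.Ioo (-Real.pi) Real.pi ⊆ Complex.polarCoord.target := by
    rw [Complex.polarCoord_target]
    exact Set.prod_mono Set.Ioc_subset_Ioi_self subset_rfl
  have hmeas : Measurable fun p : ℝ × ℝ =>
      ENNReal.ofReal p.1 * ‖f (z + Complex.polarCoord.symm p)‖ₑ ^ 2 := by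
    have : Continuous fun p : ℝ × ℝ => f (z + Complex.polarCoord.symm p) := by
      simp only [Complex.polarCoord_symm_apply]
      fun_prop
    exact (ENNReal.measurable_ofReal.comp measurable_fst).mul
      (this.measurable.enorm.pow_const 2)
  have h1 : ∫⁻ r in Set.Ioc (0 : ℝ) 1, ENNReal.ofReal r = ENNReal.ofReal (1 / 2) := by
    rw [← ofReal_integral_eq_lintegral_ofReal, ← intervalIntegral.integral_of_le zero_le_one,
      integral_id]
    · norm_num
    · exact (intervalIntegrable_iff_integrableOn_Ioc_of_le zero_le_one).1
        intervalIntegral.intervalIntegrable_id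
    · exact (ae_restrict_iff' measurableSet_Ioc).2 (Filter.Eventually.of_forall fun r hr => hr.1.le)
  rw [h0, ← Complex.lintegral_comp_polarCoord_symm]
  calc ENNReal.ofReal Real.pi * ‖f z‖ₑ ^ 2
      = ∫⁻ r in Set.Ioc (0 : ℝ) 1,
          ENNReal.ofReal r * (ENNReal.ofReal (2 * Real.pi) * ‖f z‖ₑ ^ 2) := by
        rw [lintegral_mul_const _ (by fun_prop), h1, ← mul_assoc,
          ← ENNReal.ofReal_mul (by positivity)]
        congr 3
        ring
    _ ≤ ∫⁻ r in Set.Ioc (0 : ℝ) 1, ∫⁻ θ in Set.Ioo (-Real.pi) Real.pi,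
          ENNReal.ofReal r * ‖f (z + Complex.polarCoord.symm (r, θ))‖ₑ ^ 2 := by
        refine lintegral_mono fun r => ?_
        rw [lintegral_const_mul' _ _ ENNReal.ofReal_ne_top]
        exact mul_le_mul_right (norm_sq_le_lintegral_circle hf z r) _
    _ = ∫⁻ p in (Set.Ioc (0 : ℝ) 1) ×ˢ Set.Ioo (-Real.pi) Real.pi,
          ENNReal.ofReal p.1 * ‖f (z + Complex.polarCoord.symm p)‖ₑ ^ 2 := by
        rw [Measure.volume_eq_prod, ← Measure.prod_restrict,
          lintegral_prod _ hmeas.aemeasurable]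
    _ = ∫⁻ p in (Set.Ioc (0 : ℝ) 1) ×ˢ Set.Ioo (-Real.pi) Real.pi,
          ENNReal.ofReal p.1 • G (Complex.polarCoord.symm p) := by
        refine setLIntegral_congr_fun (measurableSet_Ioc.prod measurableSet_Ioo) fun p hp => ?_
        have hp1 : Complex.polarCoord.symm p ∈ Metric.closedBall (0 : ℂ) 1 := by
          rw [mem_closedBall_zero_iff, Complex.norm_polarCoord_symm, abs_of_pos hp.1.1]
          exact hp.1.2
        simp only [hG, Set.indicator_of_mem hp1, smul_eq_mul]
    _ ≤ _ := lintegral_mono_set hs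

/-- Point evaluations are bounded on `F²`, uniformly on every disc. -/
theorem norm_apply_le (f : Fock) {z : ℂ} {R : ℝ} (hz : ‖z‖ ≤ R) :
    ‖f z‖ ≤ Real.exp ((R + 1) ^ 2 / 2) * ‖toL2 f‖ := by
  have h1 := norm_sq_le_lintegral_ball f.differentiable z
  have h2 : ∫⁻ w in Metric.closedBall z 1, ‖f w‖ₑ ^ 2
      ≤ ∫⁻ w in Metric.closedBall 0 (R + 1), ‖f w‖ₑ ^ 2 :=
    lintegral_mono_set (Metric.closedBall_subset_closedBall' (by simpa [add_comm] using hz))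
  have h3 := (h1.trans h2).trans (setLIntegral_closedBall_le (R + 1) _)
  have h4 : ∫⁻ w, ‖f w‖ₑ ^ 2 ∂gaussian = ‖toL2 f‖ₑ ^ 2 := by
    have : ‖toL2 f‖ₑ = eLpNorm f 2 gaussian := Lp.enorm_toLp f.memLp
    rw [this, eLpNorm_eq_lintegral_rpow_enorm_toReal (by norm_num) (by norm_num), ← ENNReal.rpow_natCast,
      ← ENNReal.rpow_mul]
    simp
  rw [h4, ENNReal.ofReal_mul Real.pi_pos.le, mul_assoc,
    ENNReal.mul_le_mul_iff_right (by simp [Real.pi_pos]) ENNReal.ofReal_ne_top,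
    ← ofReal_norm, ← ofReal_norm, ← ENNReal.ofReal_pow (norm_nonneg _),
    ← ENNReal.ofReal_pow (norm_nonneg _), ← ENNReal.ofReal_mul (Real.exp_pos _).le,
    ENNReal.ofReal_le_ofReal_iff (by positivity)] at h3
  refine le_of_sq_le_sq ?_ (by positivity)
  rw [mul_pow, ← Real.exp_nat_mul]
  have h5 : ((2 : ℕ) : ℝ) * ((R + 1) ^ 2 / 2) = (R + 1) ^ 2 := by
    push_cast
    ring
  rwa [h5]

theorem toL2_injective : Function.Injective toL2 := by
  rw [← LinearMap.ker_eq_bot, LinearMap.ker_eq_bot']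
  intro f hf
  ext z
  have := norm_apply_le f le_rfl (z := z)
  rw [hf, norm_zero, mul_zero] at this
  exact norm_le_zero_iff.1 this

/-- The inner product of `F²`. Mathlib's inner products are linear in the second variable, so
`core.inner f g` is the integral which is written `⟨g, f⟩` when the first variable is the linear
one. -/
@[reducible] def core : InnerProductSpace.Core ℂ Fock where
  inner f g := ∫ z, g z * conj (f z) ∂gaussian
  conj_inner_symm f g := by
    rw [← inner_toL2, ← inner_toL2, inner_conj_symm]
  re_inner_nonneg f := by
    rw [← inner_toL2]
    exact inner_self_nonneg
  add_left f g h := by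
    rw [← inner_toL2, ← inner_toL2, ← inner_toL2, map_add, inner_add_left]
  smul_left f g c := by
    rw [← inner_toL2, ← inner_toL2, map_smul, inner_smul_left]
  definite f hf := by
    rw [← inner_toL2, inner_self_eq_zero] at hf
    exact toL2_injective (hf.trans (map_zero _).symm)

instance : NormedAddCommGroup Fock := core.toNormedAddCommGroup

instance : InnerProductSpace ℂ Fock := InnerProductSpace.ofCore core.toCore

theorem inner_def (f g : Fock) : inner ℂ f g = ∫ z, g z * conj (f z) ∂gaussian := rfl

theorem norm_toL2 (f : Fock) : ‖toL2 f‖ = ‖f‖ := by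
  rw [@norm_eq_sqrt_re_inner ℂ, @norm_eq_sqrt_re_inner ℂ, inner_toL2, inner_def]

/-- `F²` as an isometric subspace of `L²`. -/
def toL2Isometry : Fock →ₗᵢ[ℂ] Lp ℂ 2 gaussian := ⟨toL2, norm_toL2⟩

/-- `F²` is a Hilbert space. -/
instance : CompleteSpace Fock := by
  refine Metric.complete_of_cauchySeq_tendsto fun u hu => ?_
  have hb : ∀ R : ℝ, UniformCauchySeqOn (fun n => (u n : ℂ → ℂ)) Filter.atTop
      (Metric.closedBall 0 R) := by
    intro R
    rw [Metric.uniformCauchySeqOn_iff]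
    intro ε hε
    obtain ⟨N, hN⟩ := Metric.cauchySeq_iff.1 hu (ε / Real.exp ((R + 1) ^ 2 / 2)) (by positivity)
    refine ⟨N, fun m hm n hn z hz => ?_⟩
    have h1 := norm_apply_le (u m - u n) (z := z) (R := R) (by simpa using hz)
    rw [norm_toL2, ← dist_eq_norm] at h1
    have h2 := hN m hm n hn
    rw [lt_div_iff₀ (by positivity), mul_comm] at h2
    rw [dist_eq_norm]
    exact h1.trans_lt h2
  have hp : ∀ z, ∃ l, Filter.Tendsto (fun n => u n z) Filter.atTop (nhds l) := fun z =>
    cauchySeq_tendsto_of_complete ((hb ‖z‖).cauchySeq (by simp))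
  choose g hg using hp
  have hunif : ∀ R : ℝ, TendstoUniformlyOn (fun n => (u n : ℂ → ℂ)) g Filter.atTop
      (Metric.closedBall 0 R) := fun R =>
    (hb R).tendstoUniformlyOn_of_tendsto fun z _ => hg z
  have hloc : TendstoLocallyUniformlyOn (fun n => (u n : ℂ → ℂ)) g Filter.atTop Set.univ := by
    rw [tendstoLocallyUniformlyOn_iff_forall_isCompact isOpen_univ]
    intro K _ hK
    obtain ⟨R, hR⟩ := hK.isBounded.subset_closedBall 0
    exact (hunif R).mono hR
  have hgd : Differentiable ℂ g := by
    rw [← differentiableOn_univ]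
    exact hloc.differentiableOn
      (Filter.Eventually.of_forall fun n => (u n).differentiable.differentiableOn) isOpen_univ
  obtain ⟨h, hh⟩ := cauchySeq_tendsto_of_complete
    (toL2Isometry.isometry.uniformContinuous.comp_cauchySeq hu)
  have hgh : g =ᵐ[gaussian] h := by
    obtain ⟨ns, hns, hae⟩ := (tendstoInMeasure_of_tendsto_Lp hh).exists_seq_tendsto_ae
    have hall : ∀ᵐ z ∂gaussian, ∀ n, toL2Isometry (u n) z = u n z :=
      ae_all_iff.2 fun n => (u n).memLp.coeFn_toLp
    filter_upwards [hae, hall] with z hz hz'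
    refine tendsto_nhds_unique ((hg z).comp hns.tendsto_atTop) ?_
    refine hz.congr fun n => ?_
    exact hz' (ns n)
  let f : Fock := ⟨g, hgd, (memLp_congr_ae hgh).2 (Lp.memLp h)⟩
  have hf : toL2Isometry f = h := by
    refine Lp.ext ?_
    exact (f.memLp.coeFn_toLp).trans hgh
  refine ⟨f, ?_⟩
  rw [toL2Isometry.isometry.isEmbedding.tendsto_nhds_iff, hf]
  exact hh

end Fock

/-- The maximal weighted composition operator `f ↦ ψ · (f ∘ φ)` in `F²`, with domain
`{f ∈ F² | ψ · (f ∘ φ) ∈ F²}`. -/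
def maxWCO (ψ φ : ℂ → ℂ) : Fock →ₗ.[ℂ] Fock where
  domain :=
    { carrier := {f : Fock | (fun z => ψ z * f (φ z)) ∈ fockSubmodule}
      zero_mem' := by
        have h : (fun z => ψ z * (0 : Fock) (φ z)) = 0 := funext fun z => mul_zero _
        change (fun z => ψ z * (0 : Fock) (φ z)) ∈ fockSubmodule
        rw [h]
        exact fockSubmodule.zero_mem
      add_mem' := fun {f g} hf hg => by
        have h : (fun z => ψ z * (f + g) (φ z)) =
            (fun z => ψ z * f (φ z)) + fun z => ψ z * g (φ z) := funext fun z => mul_add _ _ _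
        change (fun z => ψ z * (f + g) (φ z)) ∈ fockSubmodule
        rw [h]
        exact fockSubmodule.add_mem hf hg
      smul_mem' := fun c f hf => by
        have h : (fun z => ψ z * (c • f) (φ z)) = c • fun z => ψ z * f (φ z) :=
          funext fun z => mul_left_comm _ _ _
        change (fun z => ψ z * (c • f) (φ z)) ∈ fockSubmodule
        rw [h]
        exact fockSubmodule.smul_mem c hf }
  toFun :=
    { toFun := fun f => ⟨fun z => ψ z * (f : Fock) (φ z), f.2⟩
      map_add' := fun f g => Subtype.ext (funext fun z => mul_add _ _ _)
      map_smul' := fun c f => Subtype.ext (funext fun z => mul_left_comm _ _ _) }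

/-- A closed densely defined operator `T` in a Hilbert space is normal if `dom T = dom T*` and
`‖T x‖ = ‖T* x‖` for all `x ∈ dom T`. -/
structure IsNormal {H : Type*} [NormedAddCommGroup H] [InnerProductSpace ℂ H] [CompleteSpace H]
    (T : H →ₗ.[ℂ] H) : Prop where
  isClosed : T.IsClosed
  dense_domain : Dense (T.domain : Set H)
  domain_eq : T.domain = T.adjoint.domain
  norm_eq : ∀ (x : H) (hx : x ∈ T.domain) (hx' : x ∈ T.adjoint.domain),
    ‖T ⟨x, hx⟩‖ = ‖T.adjoint ⟨x, hx'⟩‖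

end FockWCO

end

noncomputable section

namespace FockWCO

/-! The kernels `kernel w`, `z ↦ e^{conj w z}`, reproduce point values, and any densely defined
restriction of a weighted composition operator has an adjoint sending `kernel z` to `conj (ψ z) •
kernel (φ z)`.

Necessity: normality puts every kernel in the domain and fixes the norm of its image, so
`IsNormal.kernel_ineq` bounds `ψ w * e^{conj z φ w}` for all `z`, `w`. Hence `ψ` has no zeros,
Borel–Carathéodory makes `log ψ` and `φ` quadratic polynomials, and comparing coefficients leaves an
affine `φ` and `ψ = C e^{Dz}` with `D (1 - conj A) = conj B (1 - A)`. The exact norm at `z = 0`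
gives `‖B‖ = ‖D‖`.

Sufficiency: for such symbols the kernels form a core of the maximal operator, because a vector
graph-orthogonal to them satisfies a functional equation whose only solution in the Fock space is
zero. So the adjoint is the maximal operator with parameters `conj A, conj D, conj C, conj B`. A
rigid motion of the plane carries one norm integral to the other, so domains and norms agree
(`lintegral_affineWCO`).

Finally `W` is maximal because a normal operator has no proper normal extension. -/

/-! ### Gaussian integrals and the mean value property -/

theorem measurable_gaussian_density :
    Measurable fun z : ℂ => ENNReal.ofReal (Real.pi⁻¹ * Real.exp (-‖z‖ ^ 2)) := by
  fun_prop

theorem lintegral_gaussian (F : ℂ → ℝ≥0∞) :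
    ∫⁻ z, F z ∂gaussian = ∫⁻ z, ENNReal.ofReal (Real.pi⁻¹ * Real.exp (-‖z‖ ^ 2)) * F z := by
  rw [gaussian, lintegral_withDensity_eq_lintegral_mul_non_measurable _ measurable_gaussian_density
    (Filter.Eventually.of_forall fun z => ENNReal.ofReal_lt_top)]
  rfl

theorem integral_gaussian (F : ℂ → ℂ) :
    ∫ z, F z ∂gaussian = ∫ z, (Real.pi⁻¹ * Real.exp (-‖z‖ ^ 2)) • F z := by
  rw [gaussian, integral_withDensity_eq_integral_toReal_smul measurable_gaussian_density
    (Filter.Eventually.of_forall fun z => ENNReal.ofReal_lt_top)]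
  refine integral_congr_ae (Filter.Eventually.of_forall fun z => ?_)
  simp only
  rw [ENNReal.toReal_ofReal (by positivity)]

theorem integrable_gaussian_iff {F : ℂ → ℂ} :
    Integrable F gaussian ↔ Integrable fun z => (Real.pi⁻¹ * Real.exp (-‖z‖ ^ 2)) • F z := by
  rw [gaussian, integrable_withDensity_iff_integrable_smul' measurable_gaussian_density
    (Filter.Eventually.of_forall fun z => ENNReal.ofReal_lt_top)]
  refine integrable_congr (Filter.Eventually.of_forall fun z => ?_)
  simp only
  rw [ENNReal.toReal_ofReal (by positivity)]

theorem memLp_gaussian_iff {f : ℂ → ℂ} (hf : Continuous f) :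
    MemLp f 2 gaussian ↔ ∫⁻ z, ‖f z‖ₑ ^ 2 ∂gaussian < ∞ := by
  have := eLpNorm_lt_top_iff_lintegral_rpow_enorm_lt_top (f := f) (μ := gaussian) (p := 2)
    (by norm_num) (by norm_num)
  simp only [ENNReal.toReal_ofNat, ENNReal.rpow_ofNat] at this
  rw [← this]
  exact ⟨fun h => h.2, fun h => ⟨hf.aestronglyMeasurable, h⟩⟩

theorem integrable_gaussian_weight :
    Integrable fun z : ℂ => Real.pi⁻¹ * Real.exp (-‖z‖ ^ 2) := by
  have := (GaussianFourier.integrable_cexp_neg_mul_sq_norm_add (b := 1) (V := ℂ)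
    (by simp) 0 0).norm
  refine (this.const_mul Real.pi⁻¹).congr (Filter.Eventually.of_forall fun z => ?_)
  simp [Complex.norm_exp, ← Complex.ofReal_pow]

theorem integral_gaussian_weight : ∫ z : ℂ, Real.pi⁻¹ * Real.exp (-‖z‖ ^ 2) = 1 := by
  have h := GaussianFourier.integral_rexp_neg_mul_sq_norm (b := 1) (V := ℂ) (by simp)
  rw [integral_const_mul]
  simp only [neg_mul, one_mul] at h
  rw [h]
  simp [Complex.finrank_real_complex, Real.pi_ne_zero]

theorem integral_circle {g : ℂ → ℂ} (hg : Differentiable ℂ g) (r : ℝ) :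
    ∫ θ in Set.Ioo (-Real.pi) Real.pi, g (Complex.polarCoord.symm (r, θ))
      = ((2 * Real.pi : ℝ) : ℂ) * g 0 := by
  have h1 : Real.circleAverage g 0 r = g 0 := hg.diffContOnCl.circleAverage
  rw [Real.circleAverage_eq_integral_add (-Real.pi)] at h1
  have h2 : ∫ θ in (0 : ℝ)..2 * Real.pi, g (circleMap 0 r (θ + -Real.pi))
      = ∫ θ in Set.Ioo (-Real.pi) Real.pi, g (Complex.polarCoord.symm (r, θ)) := by
    rw [intervalIntegral.integral_comp_add_right (fun θ => g (circleMap 0 r θ)),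
      intervalIntegral.integral_of_le (by linarith [Real.pi_pos]), integral_Ioc_eq_integral_Ioo]
    have : 2 * Real.pi + -Real.pi = Real.pi := by ring
    rw [zero_add, this]
    refine integral_congr_ae (Filter.Eventually.of_forall fun θ => ?_)
    simp [circleMap, Complex.polarCoord_symm_apply, Complex.exp_mul_I]
  rw [h2] at h1
  rw [← h1, Complex.real_smul, ← mul_assoc, ← Complex.ofReal_mul,
    mul_inv_cancel₀ (by positivity)]
  simp

/-- A radially weighted form of the mean value property. -/
theorem integral_gaussian_eq_radial {g : ℂ → ℂ} (hg : Differentiable ℂ g)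
    (hi : Integrable g gaussian) :
    ∫ z, g z ∂gaussian =
      (∫ r in Set.Ioi (0 : ℝ), ((r * (Real.pi⁻¹ * Real.exp (-r ^ 2)) * (2 * Real.pi) : ℝ) : ℂ))
        * g 0 := by
  rw [integrable_gaussian_iff] at hi
  set F : ℂ → ℂ := fun z => (Real.pi⁻¹ * Real.exp (-‖z‖ ^ 2)) • g z with hF
  have hFc : Continuous F := by
    have := hg.continuous
    fun_prop
  have hpc : Continuous fun p : ℝ × ℝ => Complex.polarCoord.symm p := by
    simp only [Complex.polarCoord_symm_apply]
    fun_prop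
  have hint : IntegrableOn (fun p : ℝ × ℝ => p.1 • F (Complex.polarCoord.symm p))
      (Set.Ioi (0 : ℝ) ×ˢ Set.Ioo (-Real.pi) Real.pi) := by
    refine ⟨(Continuous.aestronglyMeasurable (by fun_prop)), ?_⟩
    have h1 := Complex.lintegral_comp_polarCoord_symm fun z => ‖F z‖ₑ
    rw [hasFiniteIntegral_iff_enorm]
    refine lt_of_eq_of_lt (Eq.trans ?_ h1) hi.2
    rw [polarCoord_target]
    refine setLIntegral_congr_fun (measurableSet_Ioi.prod measurableSet_Ioo) fun p hp => ?_
    have hp1 : (0 : ℝ) < p.1 := hp.1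
    simp only [enorm_smul, smul_eq_mul]
    rw [Real.enorm_of_nonneg hp1.le]
  rw [integral_gaussian, ← Complex.integral_comp_polarCoord_symm, polarCoord_target,
    Measure.volume_eq_prod, setIntegral_prod _ hint, ← integral_mul_const]
  refine setIntegral_congr_fun measurableSet_Ioi fun r hr => ?_
  have hr : (0 : ℝ) < r := hr
  have h2 : ∀ θ : ℝ, r • F (Complex.polarCoord.symm (r, θ)) =
      (r * (Real.pi⁻¹ * Real.exp (-r ^ 2))) • g (Complex.polarCoord.symm (r, θ)) := by
    intro θ
    rw [hF]
    simp only [Complex.norm_polarCoord_symm, sq_abs, mul_smul]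
  simp only [h2]
  rw [integral_smul, integral_circle hg, Complex.real_smul]
  push_cast
  ring

theorem integral_gaussian_of_differentiable {g : ℂ → ℂ} (hg : Differentiable ℂ g)
    (hi : Integrable g gaussian) : ∫ z, g z ∂gaussian = g 0 := by
  have h1i : Integrable (fun _ : ℂ => (1 : ℂ)) gaussian := by
    rw [integrable_gaussian_iff]
    refine integrable_gaussian_weight.ofReal.congr (Filter.Eventually.of_forall fun z => ?_)
    simp
  -- The radial constant need not be computed: the constant function 1 and the total mass 1 show
  -- that it equals 1.
  have h1 := integral_gaussian_eq_radial (differentiable_const (1 : ℂ)) h1i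
  have h2 : ∫ _ : ℂ, (1 : ℂ) ∂gaussian = 1 := by
    rw [integral_gaussian]
    have := congrArg (fun x : ℝ => (x : ℂ)) integral_gaussian_weight
    simp only [← integral_complex_ofReal] at this
    simpa using this
  rw [h2, mul_one] at h1
  rw [integral_gaussian_eq_radial hg hi, ← h1, one_mul]

/-! ### Reproducing kernels -/

theorem weight_mul_kernel (w z : ℂ) :
    ENNReal.ofReal (Real.pi⁻¹ * Real.exp (-‖z‖ ^ 2)) * ‖cexp (conj w * z)‖ₑ ^ 2 =
      ENNReal.ofReal (Real.exp (‖w‖ ^ 2)) *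
        ENNReal.ofReal (Real.pi⁻¹ * Real.exp (-‖z - w‖ ^ 2)) := by
  rw [← ofReal_norm, Complex.norm_exp, ← ENNReal.ofReal_pow (by positivity),
    ← ENNReal.ofReal_mul (by positivity), ← ENNReal.ofReal_mul (by positivity), mul_left_comm,
    mul_assoc, ← Real.exp_nat_mul, ← Real.exp_add, ← Real.exp_add]
  congr 3
  simp only [← Complex.normSq_eq_norm_sq, Complex.normSq_apply]
  simp
  ring

theorem kernel_mem (w : ℂ) : (fun z => cexp (conj w * z)) ∈ fockSubmodule := by
  have hd : Differentiable ℂ fun z => cexp (conj w * z) := by fun_prop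
  refine ⟨hd, (memLp_gaussian_iff hd.continuous).2 ?_⟩
  rw [lintegral_gaussian]
  simp only [weight_mul_kernel]
  rw [lintegral_const_mul' _ _ ENNReal.ofReal_ne_top,
    lintegral_sub_right_eq_self fun z : ℂ => ENNReal.ofReal (Real.pi⁻¹ * Real.exp (-‖z‖ ^ 2))]
  exact ENNReal.mul_lt_top ENNReal.ofReal_lt_top integrable_gaussian_weight.lintegral_lt_top

/-- The reproducing kernel `z ↦ e^{\bar w z}` of `F²`. -/
def kernel (w : ℂ) : Fock := ⟨fun z => cexp (conj w * z), kernel_mem w⟩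

theorem kernel_apply (w z : ℂ) : kernel w z = cexp (conj w * z) := rfl

/-- Translating by `w` turns weight times conjugate kernel into the centred weight times the entire
function `e^{-conj w z}`; the Gaussian mean value property at 0 then applies. -/
theorem inner_kernel (w : ℂ) (f : Fock) : inner ℂ (kernel w) f = f w := by
  have hint : Integrable (fun z => f z * conj (kernel w z)) gaussian :=
    f.memLp.integrable_mul (kernel w).memLp.star
  have key : ∀ z : ℂ, (Real.pi⁻¹ * Real.exp (-‖z + w‖ ^ 2)) • (f (z + w) * conj (kernel w (z + w)))
      = (Real.pi⁻¹ * Real.exp (-‖z‖ ^ 2)) • (f (z + w) * cexp (-(conj w * z))) := by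
    intro z
    simp only [kernel_apply, Complex.real_smul, ← Complex.exp_conj]
    push_cast
    rw [mul_assoc, mul_assoc, mul_left_comm (cexp _) (f _), mul_left_comm (cexp _) (f _),
      ← Complex.exp_add, ← Complex.exp_add]
    congr 3
    rw [← Complex.mul_conj', ← Complex.mul_conj']
    simp only [map_add, map_mul, Complex.conj_conj]
    ring
  set g : ℂ → ℂ := fun z => f (z + w) * cexp (-(conj w * z)) with hg
  have hgd : Differentiable ℂ g := by
    have := f.differentiable
    fun_prop
  have hgi : Integrable g gaussian := by
    rw [integrable_gaussian_iff] at hint ⊢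
    refine (hint.comp_add_right w).congr (Filter.Eventually.of_forall fun z => ?_)
    exact key z
  have h := integral_gaussian_of_differentiable hgd hgi
  rw [integral_gaussian] at h
  rw [Fock.inner_def, integral_gaussian, ← integral_add_right_eq_self _ w]
  simp only [key]
  rw [h, hg]
  simp

theorem norm_kernel_sq (w : ℂ) : ‖kernel w‖ ^ 2 = Real.exp (‖w‖ ^ 2) := by
  rw [@norm_sq_eq_re_inner ℂ, inner_kernel, kernel_apply, Complex.conj_mul', ← Complex.ofReal_pow,
    ← Complex.ofReal_exp]
  exact Complex.ofReal_re _

theorem norm_kernel (w : ℂ) : ‖kernel w‖ = Real.exp (‖w‖ ^ 2 / 2) := by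
  rw [← sq_eq_sq₀ (norm_nonneg _) (Real.exp_pos _).le, norm_kernel_sq, ← Real.exp_nat_mul]
  congr 1
  push_cast
  ring

theorem norm_apply_le_exp (f : Fock) (w : ℂ) : ‖f w‖ ≤ Real.exp (‖w‖ ^ 2 / 2) * ‖f‖ := by
  rw [← inner_kernel, ← norm_kernel]
  exact norm_inner_le_norm _ _

theorem continuous_apply (w : ℂ) : Continuous fun f : Fock => f w := by
  simp only [← inner_kernel]
  fun_prop

theorem dense_of_kernel_mem {p : Submodule ℂ Fock} (h : ∀ w, kernel w ∈ p) :
    Dense (p : Set Fock) := by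
  rw [Submodule.dense_iff_topologicalClosure_eq_top, Submodule.topologicalClosure_eq_top_iff,
    Submodule.eq_bot_iff]
  intro f hf
  ext w
  rw [← inner_kernel]
  exact (Submodule.mem_orthogonal _ _).1 hf _ (h w)

theorem norm_sq_eq_lintegral (f : Fock) : ENNReal.ofReal (‖f‖ ^ 2) = ∫⁻ z, ‖f z‖ₑ ^ 2 ∂gaussian := by
  rw [← Fock.norm_toL2, ENNReal.ofReal_pow (norm_nonneg _), ofReal_norm]
  have : ‖Fock.toL2 f‖ₑ = eLpNorm f 2 gaussian := Lp.enorm_toLp f.memLp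
  rw [this, eLpNorm_eq_lintegral_rpow_enorm_toReal (by norm_num) (by norm_num),
    ← ENNReal.rpow_natCast, ← ENNReal.rpow_mul]
  simp

/-! ### Closedness and cores -/

theorem mem_maxWCO_domain {ψ φ : ℂ → ℂ} {f : Fock} :
    f ∈ (maxWCO ψ φ).domain ↔ (fun z => ψ z * f (φ z)) ∈ fockSubmodule := Iff.rfl

theorem maxWCO_apply {ψ φ : ℂ → ℂ} (f : (maxWCO ψ φ).domain) (z : ℂ) :
    maxWCO ψ φ f z = ψ z * (f : Fock) (φ z) := rfl

/-- Point evaluations are continuous, so the graph is cut out by closed conditions, one for each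
point. -/
theorem isClosed_maxWCO (ψ φ : ℂ → ℂ) : (maxWCO ψ φ).IsClosed := by
  have h : ((maxWCO ψ φ).graph : Set (Fock × Fock)) =
      ⋂ z, {p : Fock × Fock | p.2 z = ψ z * p.1 (φ z)} := by
    ext p
    simp only [SetLike.mem_coe, LinearPMap.mem_graph_iff, Set.mem_iInter, Set.mem_ofPred_eq]
    constructor
    · rintro ⟨f, hf, hg⟩ z
      rw [← hg, ← hf, maxWCO_apply]
    · intro hp
      have hm : p.1 ∈ (maxWCO ψ φ).domain := by
        rw [mem_maxWCO_domain, ← funext hp]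
        exact p.2.2
      exact ⟨⟨p.1, hm⟩, rfl, Fock.ext fun z => (hp z).symm⟩
  rw [LinearPMap.IsClosed, h]
  refine isClosed_iInter fun z => isClosed_eq ((continuous_apply z).comp continuous_snd) ?_
  exact continuous_const.mul ((continuous_apply _).comp continuous_fst)

/-- If a family of vectors of the domain of a closed operator `T` is total for the graph inner
product, then `⟪g, T f⟫ = ⟪h, f⟫` holds on the domain as soon as it holds for the family. -/
theorem inner_eq_of_core {H : Type*} [NormedAddCommGroup H] [InnerProductSpace ℂ H]
    [CompleteSpace H] {T : H →ₗ.[ℂ] H} (hT : T.IsClosed) {ι : Type*} (k : ι → T.domain)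
    (hk : ∀ f : T.domain,
      (∀ i, inner ℂ (k i : H) (f : H) + inner ℂ (T (k i)) (T f) = 0) → (f : H) = 0)
    {g h : H} (hgh : ∀ i, inner ℂ g (T (k i)) = inner ℂ h (k i : H)) (f : T.domain) :
    inner ℂ g (T f) = inner ℂ h (f : H) := by
  let e : (H × H) ≃L[ℂ] WithLp 2 (H × H) := (WithLp.prodContinuousLinearEquiv 2 ℂ H H).symm
  let G : Submodule ℂ (WithLp 2 (H × H)) := T.graph.map (e : (H × H) →ₗ[ℂ] WithLp 2 (H × H))
  let M : Submodule ℂ (WithLp 2 (H × H)) := Submodule.span ℂ (Set.range fun i => e (k i, T (k i)))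
  have hG : IsClosed (G : Set (WithLp 2 (H × H))) := by
    change IsClosed (e '' T.graph)
    exact e.toHomeomorph.isClosed_image.2 hT
  have hmem : ∀ f : T.domain, e (f, T f) ∈ G := fun f => ⟨_, T.mem_graph f, rfl⟩
  have hMG : M.topologicalClosure ≤ G := by
    refine Submodule.topologicalClosure_minimal _ (Submodule.span_le.2 ?_) hG
    rintro _ ⟨i, rfl⟩
    exact hmem (k i)
  have hsup := Submodule.sup_orthogonal_inf_of_hasOrthogonalProjection hMG
  have hbot : M.topologicalClosureᗮ ⊓ G = ⊥ := by
    rw [Submodule.eq_bot_iff]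
    rintro x ⟨hx, ⟨p, hp, rfl⟩⟩
    rw [SetLike.mem_coe, LinearPMap.mem_graph_iff] at hp
    obtain ⟨f, hf1, hf2⟩ := hp
    have h0 : (f : H) = 0 := by
      refine hk f fun i => ?_
      have := (Submodule.mem_orthogonal _ _).1 hx (e (k i, T (k i)))
        (M.le_topologicalClosure (Submodule.subset_span ⟨i, rfl⟩))
      rw [WithLp.prod_inner_apply] at this
      rw [hf1, hf2]
      exact this
    have h1 : f = 0 := Subtype.ext h0
    have hp0 : p = 0 := Prod.ext (by rw [← hf1, h0]; rfl) (by rw [← hf2, h1, T.map_zero]; rfl)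
    rw [hp0]
    exact map_zero _
  rw [hbot, sup_bot_eq] at hsup
  -- The desired identity says that `(-h, g)` is orthogonal to the graph. Since the family spans a
  -- dense part of the graph, orthogonality to the family is enough.
  have ho : e (-h, g) ∈ Mᗮ := by
    rw [Submodule.mem_orthogonal']
    intro u hu
    induction hu using Submodule.span_induction with
    | mem x hx =>
      obtain ⟨i, rfl⟩ := hx
      rw [WithLp.prod_inner_apply]
      change inner ℂ (-h) (k i : H) + inner ℂ g (T (k i)) = 0
      rw [hgh, inner_neg_left, neg_add_cancel]
    | zero => exact inner_zero_right _
    | add x y _ _ hx hy => rw [inner_add_right, hx, hy, add_zero]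
    | smul c x _ hx => rw [inner_smul_right, hx, mul_zero]
  rw [← Submodule.orthogonal_closure] at ho
  have := (Submodule.mem_orthogonal' _ _).1 ho (e (f, T f)) (hsup ▸ hmem f)
  rw [WithLp.prod_inner_apply] at this
  change inner ℂ (-h) (f : H) + inner ℂ g (T f) = 0 at this
  rw [inner_neg_left, neg_add_eq_zero] at this
  exact this.symm

/-! ### A functional equation with only the zero solution -/

/-- The map `w ↦ r w + conj E` has a fixed point `p`, and `E p` is real. Comparing leading Taylor
coefficients at `p` multiplies a nonzero number by `1 + c e^{Ep} r^n > 0`, which cannot give zero.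
-/
theorem eq_zero_of_functional_eq_of_ne_one {f : ℂ → ℂ} (hf : Differentiable ℂ f) {c r : ℝ}
    {E : ℂ} (hc : 0 ≤ c) (hr : 0 ≤ r) (hr1 : r ≠ 1)
    (h : ∀ w, f w + c * cexp (E * w) * f (r * w + conj E) = 0) (w : ℂ) : f w = 0 := by
  set p : ℂ := conj E / (1 - r) with hp
  have h1r : (1 - r : ℂ) ≠ 0 := by
    rw [sub_ne_zero]
    exact_mod_cast hr1.symm
  have hfix : (r : ℂ) * p + conj E = p := by
    rw [hp]
    field_simp
    ring
  have hEp : cexp (E * p) = (Real.exp (‖E‖ ^ 2 / (1 - r)) : ℝ) := by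
    rw [hp, mul_div_assoc', Complex.mul_conj']
    push_cast
    rfl
  by_contra hw
  have hnz : ¬ ∀ᶠ z in nhds p, f z = 0 := by
    intro h0
    have := (hf.differentiableOn.analyticOnNhd isOpen_univ).eqOn_zero_of_preconnected_of_eventuallyEq_zero
      isPreconnected_univ (Set.mem_univ p) h0
    exact hw (this (Set.mem_univ w))
  obtain ⟨n, g, hg, hgp, hfg⟩ :=
    (hf.analyticAt p).exists_eventuallyEq_pow_smul_nonzero_iff.2 hnz
  set T : ℂ → ℂ := fun z => r * z + conj E with hT
  have hTc : Filter.Tendsto T (nhds p) (nhds p) := by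
    have : Continuous T := by fun_prop
    have h2 := this.tendsto p
    simp only [hT, hfix] at h2
    exact h2
  have hTp : ∀ z, T z - p = r * (z - p) := fun z => by
    simp only [hT]
    linear_combination hfix
  have hev : ∀ᶠ z in nhdsWithin p {p}ᶜ, g z + c * cexp (E * z) * r ^ n * g (T z) = 0 := by
    have h3 := hfg.and (hTc.eventually hfg)
    filter_upwards [h3.filter_mono nhdsWithin_le_nhds, self_mem_nhdsWithin] with z hz hzp
    have hzp' : z - p ≠ 0 := sub_ne_zero.2 hzp
    have h4 := h z
    change f z + c * cexp (E * z) * f (T z) = 0 at h4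
    rw [hz.1, hz.2, hTp, mul_pow, smul_eq_mul, smul_eq_mul] at h4
    have h5 : (z - p) ^ n * (g z + c * cexp (E * z) * r ^ n * g (T z)) = 0 := by
      linear_combination h4
    exact (mul_eq_zero.1 h5).resolve_left (pow_ne_zero _ hzp')
  have hlim : Filter.Tendsto (fun z => g z + c * cexp (E * z) * r ^ n * g (T z)) (nhds p)
      (nhds (g p + c * cexp (E * p) * r ^ n * g p)) := by
    have hgc : Filter.Tendsto g (nhds p) (nhds (g p)) := hg.continuousAt
    have he : Filter.Tendsto (fun z : ℂ => (c : ℂ) * cexp (E * z) * (r : ℂ) ^ n) (nhds p)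
        (nhds (c * cexp (E * p) * r ^ n)) := by
      have : Continuous fun z : ℂ => (c : ℂ) * cexp (E * z) * (r : ℂ) ^ n := by fun_prop
      exact this.tendsto p
    exact hgc.add (he.mul (hgc.comp hTc))
  have h6 : g p + c * cexp (E * p) * r ^ n * g p = 0 :=
    tendsto_nhds_unique (hlim.mono_left nhdsWithin_le_nhds)
      (tendsto_const_nhds.congr' (hev.mono fun z hz => hz.symm))
  have h7 : ((1 + c * Real.exp (‖E‖ ^ 2 / (1 - r)) * r ^ n : ℝ) : ℂ) * g p = 0 := by
    push_cast
    rw [hEp] at h6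
    push_cast at h6
    linear_combination h6
  rcases mul_eq_zero.1 h7 with h8 | h8
  · have h9 : (0 : ℝ) < 1 + c * Real.exp (‖E‖ ^ 2 / (1 - r)) * r ^ n := by positivity
    exact h9.ne' (by exact_mod_cast h8)
  · exact hgp h8

/-- For a translation there is no fixed point, so growth is used. A Gaussian twist along the
direction `conj E` makes the function antiperiodic and bounded; by Liouville it is constant, hence
equal to its own negative. -/
theorem eq_zero_of_functional_eq_of_eq_one {f : ℂ → ℂ} (hf : Differentiable ℂ f) {c M : ℝ}
    {E : ℂ} (hc : 0 ≤ c) (hM : ∀ w, ‖f w‖ ≤ Real.exp (‖w‖ ^ 2 / 2) * M)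
    (h : ∀ w, f w + c * cexp (E * w) * f (w + conj E) = 0) (w : ℂ) : f w = 0 := by
  rcases hc.eq_or_lt with rfl | hc
  · simpa using h w
  by_cases hE : E = 0
  · have h1 := h w
    simp only [hE, zero_mul, Complex.exp_zero, mul_one, map_zero, add_zero] at h1
    have h2 : ((1 + c : ℝ) : ℂ) * f w = 0 := by
      push_cast
      linear_combination h1
    refine (mul_eq_zero.1 h2).resolve_left ?_
    exact_mod_cast (by positivity : (0 : ℝ) < 1 + c).ne'
  have hM0 : 0 ≤ M := by
    have := (norm_nonneg _).trans (hM 0)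
    simpa using this
  have hE' : conj E ≠ 0 := by simpa using hE
  set a : ℝ := ‖E‖ ^ 2 with ha
  -- Chosen so that the exponent `a s² / 2 + β s` grows by exactly `a s + log c` when `s` becomes `s
  -- + 1`.
  set β : ℝ := Real.log c - a / 2 with hβ
  have ha0 : 0 ≤ a := by positivity
  have hEE : E * conj E = a := by
    rw [Complex.mul_conj', ha]
    push_cast
    rfl
  set g : ℂ → ℂ := fun s => f (s * conj E) * cexp (a * s ^ 2 / 2 + β * s) with hg
  have hgd : Differentiable ℂ g := by fun_prop
  have hanti : ∀ s, g (s + 1) = -g s := by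
    intro s
    have h1 := h (s * conj E)
    rw [show s * conj E + conj E = (s + 1) * conj E by ring,
      show E * (s * conj E) = a * s by rw [← hEE]; ring] at h1
    simp only [hg]
    have hcexp : (c : ℂ) = cexp (Real.log c : ℝ) := by
      rw [← Complex.ofReal_exp, Real.exp_log hc]
    have h2 : cexp (a * (s + 1) ^ 2 / 2 + β * (s + 1)) =
        c * cexp (a * s) * cexp (a * s ^ 2 / 2 + β * s) := by
      rw [hcexp, ← Complex.exp_add, ← Complex.exp_add]
      congr 1
      rw [hβ]
      push_cast
      ring
    rw [h2]
    linear_combination cexp (a * s ^ 2 / 2 + β * s) * h1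
  have hper : Function.Periodic (fun s => ‖g s‖) 1 := fun s => by
    simp only [hanti, norm_neg]
  have hbd : ∀ s, ‖g s‖ ≤ M * Real.exp (a + |β|) := by
    intro s
    have h1 : ‖g (s - (⌊s.re⌋ : ℤ) * 1)‖ = ‖g s‖ := hper.sub_int_mul_eq ⌊s.re⌋
    rw [← h1]
    set t : ℂ := s - (⌊s.re⌋ : ℤ) * 1 with ht
    have hre : t.re = Int.fract s.re := by
      rw [ht, Complex.sub_re, mul_one, Complex.intCast_re, Int.self_sub_floor]
    have h0 : 0 ≤ t.re := hre ▸ Int.fract_nonneg _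
    have h2 : t.re ≤ 1 := hre ▸ (Int.fract_lt_one _).le
    simp only [hg, norm_mul, Complex.norm_exp]
    have h3 := hM (t * conj E)
    have h4 : ‖t * conj E‖ ^ 2 / 2 = a * (t.re ^ 2 + t.im ^ 2) / 2 := by
      rw [norm_mul, mul_pow, RCLike.norm_conj, ← ha, ← Complex.normSq_eq_norm_sq t,
        Complex.normSq_apply]
      ring
    have h5 : ((a : ℂ) * t ^ 2 / 2 + β * t).re = a * (t.re ^ 2 - t.im ^ 2) / 2 + β * t.re := by
      simp [pow_two]
    rw [h4] at h3
    rw [h5]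
    -- The growth bound and the twist cancel in `t.im ^ 2`, leaving only `t.re`, which lies in `[0,
    -- 1]`.
    calc ‖f (t * conj E)‖ * Real.exp (a * (t.re ^ 2 - t.im ^ 2) / 2 + β * t.re)
        ≤ Real.exp (a * (t.re ^ 2 + t.im ^ 2) / 2) * M *
          Real.exp (a * (t.re ^ 2 - t.im ^ 2) / 2 + β * t.re) := by gcongr
      _ = M * Real.exp (a * t.re ^ 2 + β * t.re) := by
        rw [mul_comm _ M, mul_assoc, ← Real.exp_add]
        ring_nf
      _ ≤ M * Real.exp (a + |β|) := by
        have h6 : β * t.re ≤ |β| := by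
          calc β * t.re ≤ |β| * t.re := by gcongr; exact le_abs_self β
            _ ≤ |β| * 1 := by gcongr
            _ = |β| := mul_one _
        have h7 : a * t.re ^ 2 ≤ a := mul_le_of_le_one_right ha0 (pow_le_one₀ h0 h2)
        gcongr
  have hconst := hgd.apply_eq_apply_of_bounded
    (isBounded_iff_forall_norm_le.2 ⟨_, by rintro _ ⟨s, rfl⟩; exact hbd s⟩)
  have hz : g (w / conj E) = 0 := by
    have h1 := hanti (w / conj E)
    rw [hconst _ (w / conj E)] at h1
    exact self_eq_neg.1 h1
  simp only [hg, div_mul_cancel₀ _ hE'] at hz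
  exact (mul_eq_zero.1 hz).resolve_right (Complex.exp_ne_zero _)

theorem eq_zero_of_functional_eq (f : Fock) {c r : ℝ} {E : ℂ} (hc : 0 ≤ c) (hr : 0 ≤ r)
    (h : ∀ w, f w + c * cexp (E * w) * f (r * w + conj E) = 0) : f = 0 := by
  ext w
  by_cases hr1 : r = 1
  · refine eq_zero_of_functional_eq_of_eq_one f.differentiable (E := E) hc (norm_apply_le_exp f)
      (fun w => ?_) w
    simpa [hr1] using h w
  · exact eq_zero_of_functional_eq_of_ne_one f.differentiable hc hr hr1 h w

/-! ### Affine symbols: core of kernels and adjoint -/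

/-- The weight `C e^{Dz}`. -/
def expWeight (C D : ℂ) : ℂ → ℂ := fun z => C * cexp (D * z)

/-- The affine map `Az + B`. -/
def affineSymbol (A B : ℂ) : ℂ → ℂ := fun z => A * z + B

/-- The weighted composition operator with affine symbol and exponential weight. -/
abbrev affineWCO (A B C D : ℂ) : Fock →ₗ.[ℂ] Fock := maxWCO (expWeight C D) (affineSymbol A B)

theorem affineWCO_apply {A B C D : ℂ} (f : (affineWCO A B C D).domain) (z : ℂ) :
    affineWCO A B C D f z = C * cexp (D * z) * (f : Fock) (A * z + B) := rfl

theorem expWeight_mul_kernel (A B C D w z : ℂ) :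
    expWeight C D z * kernel w (affineSymbol A B z) =
      (C * cexp (conj w * B)) * kernel (conj A * w + conj D) z := by
  simp only [expWeight, affineSymbol, kernel_apply]
  rw [mul_assoc, mul_assoc, ← Complex.exp_add, ← Complex.exp_add]
  congr 2
  simp only [map_add, map_mul, Complex.conj_conj]
  ring

theorem kernel_mem_affineWCO (A B C D w : ℂ) : kernel w ∈ (affineWCO A B C D).domain := by
  rw [mem_maxWCO_domain]
  simp only [expWeight_mul_kernel]
  exact fockSubmodule.smul_mem _ (kernel _).2

theorem affineWCO_kernel (A B C D w : ℂ) :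
    affineWCO A B C D ⟨kernel w, kernel_mem_affineWCO A B C D w⟩ =
      (C * cexp (conj w * B)) • kernel (conj A * w + conj D) :=
  Fock.ext fun z => expWeight_mul_kernel A B C D w z

theorem inner_affineWCO_kernel (A B C D w : ℂ) (f : Fock) :
    inner ℂ (affineWCO A B C D ⟨kernel w, kernel_mem_affineWCO A B C D w⟩) f =
      conj C * cexp (conj B * w) * f (conj A * w + conj D) := by
  rw [affineWCO_kernel, inner_smul_left, inner_kernel, map_mul, ← Complex.exp_conj, map_mul,
    Complex.conj_conj, mul_comm w]

theorem dense_affineWCO (A B C D : ℂ) : Dense ((affineWCO A B C D).domain : Set Fock) :=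
  dense_of_kernel_mem (kernel_mem_affineWCO A B C D)

/-- The kernels form a core: by the reproducing property, graph-orthogonality becomes the functional
equation above, with nonnegative `c` and `r`. -/
theorem affineWCO_graph_orthogonal_kernel {A B C D : ℂ} (f : (affineWCO A B C D).domain)
    (h : ∀ w, inner ℂ (kernel w) (f : Fock) +
      inner ℂ (affineWCO A B C D ⟨kernel w, kernel_mem_affineWCO A B C D w⟩)
        (affineWCO A B C D f) = 0) : (f : Fock) = 0 := by
  refine eq_zero_of_functional_eq (f : Fock) (c := ‖C‖ ^ 2 * Real.exp (‖D‖ ^ 2)) (r := ‖A‖ ^ 2)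
    (E := conj B + D * conj A) (by positivity) (by positivity) fun w => ?_
  have h1 := h w
  rw [inner_kernel, inner_affineWCO_kernel, affineWCO_apply] at h1
  have h2 : A * (conj A * w + conj D) + B =
      ((‖A‖ ^ 2 : ℝ) : ℂ) * w + conj (conj B + D * conj A) := by
    push_cast
    rw [← Complex.mul_conj', map_add, map_mul, Complex.conj_conj, Complex.conj_conj]
    ring
  have h3 : conj C * cexp (conj B * w) * (C * cexp (D * (conj A * w + conj D))) =
      ((‖C‖ ^ 2 * Real.exp (‖D‖ ^ 2) : ℝ) : ℂ) * cexp ((conj B + D * conj A) * w) := by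
    push_cast
    have h4 : cexp (conj B * w) * cexp (D * (conj A * w + conj D)) =
        cexp (D * conj D) * cexp ((conj B + D * conj A) * w) := by
      rw [← Complex.exp_add, ← Complex.exp_add]
      congr 1
      ring
    rw [← Complex.mul_conj', ← Complex.mul_conj']
    linear_combination C * conj C * h4
  rw [← mul_assoc, h2, h3] at h1
  exact h1

/-- Testing against kernels determines the pointwise values of the adjoint. Conversely, the adjoint
relation holds on kernels and extends to the whole domain because they form a core. -/
theorem mem_adjoint_domain_affineWCO {A B C D : ℂ} {g : Fock} :
    g ∈ (affineWCO A B C D).adjoint.domain ↔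
      g ∈ (affineWCO (conj A) (conj D) (conj C) (conj B)).domain := by
  have hd := dense_affineWCO A B C D
  constructor
  · intro hg
    rw [mem_maxWCO_domain]
    convert ((affineWCO A B C D).adjoint ⟨g, hg⟩).2 using 1
    funext w
    have h1 := LinearPMap.adjoint_isFormalAdjoint hd ⟨g, hg⟩
      ⟨kernel w, kernel_mem_affineWCO A B C D w⟩
    have h2 := congrArg conj h1
    rw [inner_conj_symm, inner_conj_symm, inner_kernel, inner_affineWCO_kernel] at h2
    exact h2.symm
  · intro hg
    refine LinearPMap.mem_adjoint_domain_of_exists _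
      ⟨affineWCO (conj A) (conj D) (conj C) (conj B) ⟨g, hg⟩, fun f => ?_⟩
    refine (inner_eq_of_core (isClosed_maxWCO _ _)
      (fun w => ⟨kernel w, kernel_mem_affineWCO A B C D w⟩)
      affineWCO_graph_orthogonal_kernel (fun w => ?_) f).symm
    rw [← inner_conj_symm, inner_affineWCO_kernel, ← inner_conj_symm (affineWCO _ _ _ _ _),
      inner_kernel, affineWCO_apply]

theorem adjoint_affineWCO_apply {A B C D : ℂ} {g : Fock}
    (hg : g ∈ (affineWCO A B C D).adjoint.domain)
    (hg' : g ∈ (affineWCO (conj A) (conj D) (conj C) (conj B)).domain) :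
    (affineWCO A B C D).adjoint ⟨g, hg⟩ =
      affineWCO (conj A) (conj D) (conj C) (conj B) ⟨g, hg'⟩ := by
  ext w
  have h1 := LinearPMap.adjoint_isFormalAdjoint (dense_affineWCO A B C D) ⟨g, hg⟩
    ⟨kernel w, kernel_mem_affineWCO A B C D w⟩
  have h2 := congrArg conj h1
  rw [inner_conj_symm, inner_conj_symm, inner_kernel, inner_affineWCO_kernel] at h2
  exact h2

/-! ### Normality by a rigid change of variables -/

/-- The motion `z ↦ u z + b`, with `u = A / conj A` unimodular, is the one that `conj A * · + conj
D` sends to `A z + B`. The relation `hrel` matches the linear terms, and together with `‖B‖ = ‖D‖`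
it makes the constants cancel. -/
theorem norm_sq_comp_rigid {A B D z : ℂ} (hA : A ≠ 0) (hBD : ‖B‖ = ‖D‖)
    (hrel : D * (1 - conj A) = conj B * (1 - A)) :
    2 * (conj B * (A / conj A * z + (B - conj D) / conj A)).re
        - ‖A / conj A * z + (B - conj D) / conj A‖ ^ 2
      = 2 * (D * z).re - ‖z‖ ^ 2 := by
  have hA' : conj A ≠ 0 := by simpa using hA
  have hBD' : B * conj B = D * conj D := by
    rw [Complex.mul_conj', Complex.mul_conj', hBD]
  set u : ℂ := A / conj A with hu
  set b : ℂ := (B - conj D) / conj A with hb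
  have huA : u * conj A = A := div_mul_cancel₀ _ hA'
  have huu : u * conj u = 1 := by
    rw [hu, map_div₀, Complex.conj_conj]
    field_simp
  have hbA : conj b * A = conj B - D := by
    rw [hb, map_div₀, map_sub, Complex.conj_conj, Complex.conj_conj, div_mul_cancel₀ _ hA]
  have hz : (conj B - conj b) * u = D := by
    refine mul_right_cancel₀ hA' ?_
    linear_combination (conj B - conj b) * huA - hbA + hrel
  have hz' : (B - b) * conj u = conj D := by
    have := congrArg conj hz
    simpa using this
  have hc : (B - b) * (conj B - conj b) = D * conj D := by
    linear_combination (B - b) * conj u * hz + D * hz' - (B - b) * (conj B - conj b) * huu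
  have hre : ∀ x : ℂ, ((2 * x.re : ℝ) : ℂ) = x + conj x := fun x => by
    rw [Complex.add_conj]
  rw [← Complex.ofReal_inj, Complex.ofReal_sub, Complex.ofReal_sub, hre, hre, Complex.ofReal_pow,
    Complex.ofReal_pow, ← Complex.mul_conj', ← Complex.mul_conj']
  simp only [map_add, map_mul, Complex.conj_conj]
  linear_combination z * hz + conj z * hz' - z * conj z * huu + hBD' - hc

theorem lintegral_affineWCO {A B C D : ℂ} (hBD : ‖B‖ = ‖D‖)
    (hrel : D * (1 - conj A) = conj B * (1 - A)) (f : Fock) :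
    ∫⁻ z, ‖expWeight C D z * f (affineSymbol A B z)‖ₑ ^ 2 ∂gaussian =
      ∫⁻ z, ‖expWeight (conj C) (conj B) z *
        f (affineSymbol (conj A) (conj D) z)‖ₑ ^ 2 ∂gaussian := by
  -- Here no rigid motion exists, but `φ` is constant and `D = conj B`, so both integrands already
  -- coincide.
  by_cases hA : A = 0
  · have hD : D = conj B := by simpa [hA] using hrel
    simp only [expWeight, affineSymbol, hA, hD, map_zero, zero_mul, zero_add, Complex.conj_conj,
      enorm_mul, RCLike.enorm_conj]
  have hA' : conj A ≠ 0 := by simpa using hA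
  set b : ℂ := (B - conj D) / conj A with hb
  have hu : ‖A / conj A‖ = 1 := by
    rw [norm_div, RCLike.norm_conj, div_self (norm_ne_zero_iff.2 hA)]
  let R : ℂ ≃ₗᵢ[ℝ] ℂ := rotation ⟨A / conj A, mem_sphere_zero_iff_norm.2 hu⟩
  have hR : ∀ z, R z = A / conj A * z := fun z => rfl
  rw [eq_comm, lintegral_gaussian, lintegral_gaussian,
    ← lintegral_add_right_eq_self _ b,
    ← R.measurePreserving.lintegral_comp_emb R.toHomeomorph.measurableEmbedding]
  refine lintegral_congr fun z => ?_
  have h1 : affineSymbol (conj A) (conj D) (R z + b) = affineSymbol A B z := by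
    simp only [affineSymbol, hR, hb]
    field_simp
    ring
  rw [h1, enorm_mul, enorm_mul, mul_pow, mul_pow, ← mul_assoc, ← mul_assoc]
  congr 1
  simp only [expWeight, enorm_mul, mul_pow, RCLike.enorm_conj]
  rw [mul_left_comm, mul_left_comm (ENNReal.ofReal _)]
  congr 1
  rw [← ofReal_norm, ← ofReal_norm, ← ENNReal.ofReal_pow (norm_nonneg _),
    ← ENNReal.ofReal_pow (norm_nonneg _), ← ENNReal.ofReal_mul (by positivity),
    ← ENNReal.ofReal_mul (by positivity), Complex.norm_exp, Complex.norm_exp, mul_assoc, mul_assoc,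
    ← Real.exp_nat_mul, ← Real.exp_nat_mul, ← Real.exp_add, ← Real.exp_add, hR]
  congr 3
  have := norm_sq_comp_rigid (z := z) hA hBD hrel
  push_cast
  linarith

theorem isNormal_affineWCO {A B C D : ℂ} (hBD : ‖B‖ = ‖D‖)
    (hrel : D * (1 - conj A) = conj B * (1 - A)) : IsNormal (affineWCO A B C D) := by
  have hdiff : ∀ (A B C D : ℂ) (f : Fock),
      Differentiable ℂ fun z => expWeight C D z * f (affineSymbol A B z) := by
    intro A B C D f
    have := f.differentiable
    unfold expWeight affineSymbol
    fun_prop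
  have hmem : ∀ (A B C D : ℂ) (f : Fock), f ∈ (affineWCO A B C D).domain ↔
      ∫⁻ z, ‖expWeight C D z * f (affineSymbol A B z)‖ₑ ^ 2 ∂gaussian < ∞ := by
    intro A B C D f
    rw [mem_maxWCO_domain, ← memLp_gaussian_iff (hdiff A B C D f).continuous]
    exact ⟨fun h => h.2, fun h => ⟨hdiff A B C D f, h⟩⟩
  have hdom : ∀ f : Fock, f ∈ (affineWCO A B C D).domain ↔
      f ∈ (affineWCO (conj A) (conj D) (conj C) (conj B)).domain := by
    intro f
    rw [hmem, hmem, lintegral_affineWCO hBD hrel]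
  refine ⟨isClosed_maxWCO _ _, dense_affineWCO A B C D, ?_, fun f hf hf' => ?_⟩
  · ext f
    rw [hdom, mem_adjoint_domain_affineWCO]
  · rw [adjoint_affineWCO_apply hf' ((hdom f).1 hf), ← sq_eq_sq₀ (norm_nonneg _) (norm_nonneg _),
      ← ENNReal.ofReal_eq_ofReal_iff (by positivity) (by positivity), norm_sq_eq_lintegral,
      norm_sq_eq_lintegral]
    exact lintegral_affineWCO hBD hrel f

/-! ### Growth estimates and comparison of coefficients -/

theorem nonpos_of_quadratic_le {a b c : ℝ} (h : ∀ t : ℝ, a * t ^ 2 + b * t ≤ c) : a ≤ 0 := by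
  by_contra! ha
  have h1 := h ((|b| + |c| + 1) / a + 1)
  set s := (|b| + |c| + 1) / a with hs
  have hs0 : 0 ≤ s := by positivity
  have has : a * s = |b| + |c| + 1 := by
    rw [hs]
    field_simp
  have h2 : a * (s + 1) ^ 2 + b * (s + 1) = (a * s + a + b) * (s + 1) := by ring
  have h3 : |c| + 1 ≤ a * s + a + b := by
    rw [has]
    linarith [neg_abs_le b]
  have h4 : (|c| + 1) * 1 ≤ (a * s + a + b) * (s + 1) :=
    mul_le_mul h3 (by linarith) zero_le_one (by linarith [abs_nonneg c])
  linarith [le_abs_self c]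

theorem eq_zero_of_forall_mul_le {a c : ℝ} (h : ∀ t : ℝ, a * t ≤ c) : a = 0 := by
  have h1 : a ^ 2 ≤ 0 := nonpos_of_quadratic_le (b := 0) (c := |c|) fun t => by
    rcases le_total 0 t with _ | _
    · by_contra! h3
      have h4 := h (a * t ^ 2)
      have h5 := le_abs_self c
      nlinarith
    · by_contra! h3
      have h4 := h (a * t ^ 2)
      have h5 := le_abs_self c
      nlinarith
  nlinarith [sq_nonneg a]

theorem eq_zero_of_forall_re_mul_le {a : ℂ} {c : ℝ} (h : ∀ z : ℂ, (a * z).re ≤ c) : a = 0 := by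
  have h1 : ‖a‖ ^ 2 = 0 := eq_zero_of_forall_mul_le (c := c) fun t => by
    have := h (conj a * t)
    rwa [← mul_assoc, Complex.mul_conj', ← Complex.ofReal_pow, ← Complex.ofReal_mul,
      Complex.ofReal_re] at this
  simpa using h1

theorem exists_entire_log {ψ : ℂ → ℂ} (hψ : Differentiable ℂ ψ) (h0 : ∀ z, ψ z ≠ 0) :
    ∃ q : ℂ → ℂ, Differentiable ℂ q ∧ ∀ z, ψ z = cexp (q z) := by
  have hd : Differentiable ℂ fun z => deriv ψ z / ψ z := hψ.deriv.div hψ h0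
  obtain ⟨q, hq⟩ := hd.isExactOn_univ
  have hq' : ∀ z, HasDerivAt q (deriv ψ z / ψ z) z := fun z => hq z (Set.mem_univ z)
  have hqd : Differentiable ℂ q := fun z => (hq' z).differentiableAt
  have hder : ∀ z, HasDerivAt (fun z => ψ z * cexp (-q z)) 0 z := fun z => by
    refine ((hψ z).hasDerivAt.mul (hq' z).neg.cexp).congr_deriv ?_
    have := h0 z
    field_simp
    ring
  have hconst : ∀ z, ψ z * cexp (-q z) = ψ 0 * cexp (-q 0) := fun z =>
    is_const_of_deriv_eq_zero (fun z => (hder z).differentiableAt) (fun z => (hder z).deriv) z 0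
  refine ⟨fun z => q z - q 0 + Complex.log (ψ 0), by fun_prop, fun z => ?_⟩
  rw [Complex.exp_add, Complex.exp_log (h0 0), Complex.exp_sub]
  have := hconst z
  rw [Complex.exp_neg, Complex.exp_neg] at this
  field_simp at this
  field_simp
  linear_combination this

/-- An entire function whose real part grows at most quadratically is a quadratic polynomial. -/
theorem eq_quadratic_of_re_le {f : ℂ → ℂ} (hf : Differentiable ℂ f) {c : ℝ}
    (h : ∀ w, (f w).re ≤ ‖w‖ ^ 2 / 2 + c) :
    ∃ a₀ a₁ a₂ : ℂ, ∀ w, f w = a₀ + a₁ * w + a₂ * w ^ 2 := by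
  -- Borel–Carathéodory on the disc of radius `2R` yields `4R²` plus the remaining constants,
  -- absorbed using `R ≥ 1`. Cauchy's estimates then kill all derivatives of order at least 3.
  set K : ℝ := 4 + 2 * |c| + 2 + 3 * ‖f 0‖ with hK
  have hK0 : 0 ≤ K := by positivity
  have hgrow : ∀ R : ℝ, 1 ≤ R → ∀ z ∈ Metric.sphere (0 : ℂ) R, ‖f z‖ ≤ K * R ^ 2 := by
    intro R hR z hz
    have hz' : ‖z‖ = R := by simpa using hz
    have h1 := Complex.borelCaratheodory (M := (2 * R) ^ 2 / 2 + |c| + 1) (R := 2 * R) (z := z)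
      (by positivity) hf.differentiableOn (fun w hw => ?_) (by linarith) (by simp [hz']; linarith)
    · have h2 : 2 * R - ‖z‖ = R := by rw [hz']; ring
      rw [h2, hz'] at h1
      have hR0 : R ≠ 0 := by positivity
      have h3 : 2 * ((2 * R) ^ 2 / 2 + |c| + 1) * R / R + ‖f 0‖ * (2 * R + R) / R
          = 4 * R ^ 2 + (2 * |c| + 2 + 3 * ‖f 0‖) := by
        field_simp
        ring
      rw [h3] at h1
      have h4 : (2 * |c| + 2 + 3 * ‖f 0‖) * 1 ≤ (2 * |c| + 2 + 3 * ‖f 0‖) * R ^ 2 := by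
        gcongr
        exact one_le_pow₀ hR
      rw [hK]
      linarith
    · have hw' : ‖w‖ ≤ 2 * R := by
        have := mem_ball_zero_iff.1 hw
        exact this.le
      have h2 : ‖w‖ ^ 2 ≤ (2 * R) ^ 2 := by gcongr
      have h3 := h w
      have h4 := le_abs_self c
      change (f w).re ≤ _
      linarith
  have hzero : ∀ n : ℕ, iteratedDeriv (n + 3) f 0 = 0 := by
    intro n
    have hb : ∀ R : ℝ, 1 ≤ R → ‖iteratedDeriv (n + 3) f 0‖ ≤ ((n + 3).factorial * K) / R := by
      intro R hR
      have hR0 : 0 < R := by linarith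
      refine (Complex.norm_iteratedDeriv_le_of_forall_mem_sphere_norm_le (n + 3) hR0
        hf.diffContOnCl (hgrow R hR)).trans ?_
      have h5 : ((n + 3).factorial : ℝ) * (K * R ^ 2) / R ^ (n + 3) =
          ((n + 3).factorial * K) / R ^ (n + 1) := by
        field_simp
        ring
      rw [h5]
      gcongr
      exact le_self_pow₀ hR (by omega)
    have hlim : Filter.Tendsto (fun R : ℝ => ((n + 3).factorial * K) / R) Filter.atTop (nhds 0) :=
      Filter.Tendsto.const_div_atTop Filter.tendsto_id _
    have := ge_of_tendsto hlim ((Filter.eventually_ge_atTop 1).mono hb)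
    exact norm_le_zero_iff.1 this
  refine ⟨f 0, deriv f 0, 2⁻¹ * iteratedDeriv 2 f 0, fun w => ?_⟩
  rw [← Complex.taylorSeries_eq_of_entire' 0 w hf, tsum_eq_sum (s := Finset.range 3)]
  · simp [Finset.sum_range_succ]
  · intro n hn
    obtain ⟨m, rfl⟩ : ∃ m, n = m + 3 := ⟨n - 3, by simp at hn; omega⟩
    rw [hzero, mul_zero, zero_mul]

/-- If `ψ = exp(a₀ + a₁ w + a₂ w²)` and `φ = A w + B` satisfy the reproducing kernel inequality,
then `ψ` has no quadratic term, and its linear term is tied to `φ`. -/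
theorem linear_of_kernel_ineq {a₀ a₁ a₂ A B : ℂ}
    (h : ∀ z w : ℂ, ((a₀ + a₁ * w + a₂ * w ^ 2) + conj z * (A * w + B)).re ≤
      ‖w‖ ^ 2 / 2 + ((a₀ + a₁ * z + a₂ * z ^ 2).re + ‖A * z + B‖ ^ 2 / 2)) :
    a₂ = 0 ∧ a₁ * (1 - conj A) = conj B * (1 - A) := by
  have hsq : ∀ x : ℂ, ‖x‖ ^ 2 = (x * conj x).re := fun x => by
    rw [Complex.mul_conj', ← Complex.ofReal_pow, Complex.ofReal_re]
  -- This is the `t²` coefficient along `(t z, t (conj A z + v))`: with `w = conj A z + v`, the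
  -- quadratic terms without `a₂` complete to the square `‖v‖² / 2`.
  have hquad : ∀ z v : ℂ, (a₂ * ((conj A * z + v) ^ 2 - z ^ 2)).re ≤ ‖v‖ ^ 2 / 2 := by
    intro z v
    rw [← sub_nonpos]
    refine nonpos_of_quadratic_le
      (b := (a₁ * (conj A * z + v - z) + conj z * B - A * z * conj B).re)
      (c := ‖B‖ ^ 2 / 2) fun t => ?_
    have h1 := h (t * z) (t * (conj A * z + v))
    simp only [hsq] at h1 ⊢
    rw [← sub_nonneg] at h1 ⊢
    refine h1.trans_eq ?_
    simp [pow_two]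
    ring
  have ha₂ : a₂ = 0 := by
    by_cases hA : conj A ^ 2 = 1
    · have hA' : conj A ≠ 0 := by
        rintro h0
        simp [h0] at hA
      have h2 : 2 * a₂ * conj A = 0 := by
        refine eq_zero_of_forall_re_mul_le (c := 1 / 2 - a₂.re) fun z => ?_
        have h3 := hquad z 1
        have h4 : a₂ * ((conj A * z + 1) ^ 2 - z ^ 2) = 2 * a₂ * conj A * z + a₂ := by
          linear_combination a₂ * z ^ 2 * hA
        rw [h4, Complex.add_re, norm_one] at h3
        linarith
      simpa [hA'] using h2
    -- With `v = 0`, this square root turns the left side of `hquad` into a squared norm.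
    · obtain ⟨z, hz⟩ := IsAlgClosed.exists_pow_nat_eq (conj (a₂ * (conj A ^ 2 - 1))) two_pos
      have h3 := hquad z 0
      have h4 : a₂ * ((conj A * z + 0) ^ 2 - z ^ 2) =
          ((‖a₂ * (conj A ^ 2 - 1)‖ ^ 2 : ℝ) : ℂ) := by
        push_cast
        rw [← Complex.mul_conj', ← hz]
        ring
      rw [h4, Complex.ofReal_re, norm_zero] at h3
      have h5 : ‖a₂ * (conj A ^ 2 - 1)‖ = 0 := by
        have := norm_nonneg (a₂ * (conj A ^ 2 - 1))
        nlinarith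
      exact (mul_eq_zero.1 (norm_eq_zero.1 h5)).resolve_right (sub_ne_zero.2 hA)
  refine ⟨ha₂, ?_⟩
  -- At `w = conj A z` all quadratic terms cancel, and a real-linear form bounded above vanishes.
  have h2 : a₁ * conj A + conj B - a₁ - A * conj B = 0 := by
    refine eq_zero_of_forall_re_mul_le (c := ‖B‖ ^ 2 / 2) fun z => ?_
    have h1 := h z (conj A * z)
    simp only [hsq, ha₂] at h1 ⊢
    rw [← sub_nonneg] at h1 ⊢
    refine h1.trans_eq ?_
    simp
    ring
  linear_combination -h2

/-! ### Symbols of a normal operator -/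

section Normal

variable {ψ φ : ℂ → ℂ} {W : Fock →ₗ.[ℂ] Fock}

theorem inner_kernel_restriction (hW : W ≤ maxWCO ψ φ) (z : ℂ) (f : W.domain) :
    inner ℂ (conj (ψ z) • kernel (φ z)) (f : Fock) = inner ℂ (kernel z) (W f) := by
  rw [inner_smul_left, inner_kernel, inner_kernel, Complex.conj_conj,
    hW.2 (y := ⟨f, hW.1 f.2⟩) rfl, maxWCO_apply]

/-- A normal restriction of a weighted composition operator is defined on the kernels. -/
theorem IsNormal.exists_image_kernel (hn : IsNormal W) (hW : W ≤ maxWCO ψ φ) (z : ℂ) :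
    ∃ g : Fock, (∀ w, g w = ψ w * cexp (conj z * φ w)) ∧
      ‖g‖ = ‖ψ z‖ * Real.exp (‖φ z‖ ^ 2 / 2) := by
  have hz' : kernel z ∈ W.adjoint.domain :=
    LinearPMap.mem_adjoint_domain_of_exists _ ⟨_, inner_kernel_restriction hW z⟩
  have hz : kernel z ∈ W.domain := hn.domain_eq ▸ hz'
  refine ⟨W ⟨kernel z, hz⟩, fun w => ?_, ?_⟩
  · rw [hW.2 (y := ⟨kernel z, hW.1 hz⟩) rfl, maxWCO_apply, kernel_apply]
  · rw [hn.norm_eq _ hz hz',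
      LinearPMap.adjoint_apply_eq hn.dense_domain ⟨kernel z, hz'⟩ (inner_kernel_restriction hW z),
      norm_smul, RCLike.norm_conj, norm_kernel]

theorem IsNormal.kernel_ineq (hn : IsNormal W) (hW : W ≤ maxWCO ψ φ) (z w : ℂ) :
    ‖ψ w * cexp (conj z * φ w)‖ ≤
      Real.exp (‖w‖ ^ 2 / 2) * (‖ψ z‖ * Real.exp (‖φ z‖ ^ 2 / 2)) := by
  obtain ⟨g, hg, hg'⟩ := hn.exists_image_kernel hW z
  rw [← hg, ← hg']
  exact norm_apply_le_exp g w

theorem IsNormal.symbol_form (hn : IsNormal W) (hW : W ≤ maxWCO ψ φ) (hψ : Differentiable ℂ ψ)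
    (hφ : Differentiable ℂ φ) (hψ0 : ∃ z, ψ z ≠ 0) :
    ∃ A B C D : ℂ, (∀ z, φ z = A * z + B) ∧ (∀ z, ψ z = C * cexp (D * z)) ∧ ‖B‖ = ‖D‖ ∧
      D * (1 - conj A) = conj B * (1 - A) := by
  have hineq := hn.kernel_ineq hW
  have hne : ∀ z, ψ z ≠ 0 := by
    intro z hz
    obtain ⟨w, hw⟩ := hψ0
    have := hineq z w
    rw [hz, norm_zero, zero_mul, mul_zero, norm_le_zero_iff] at this
    exact mul_ne_zero hw (Complex.exp_ne_zero _) this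
  obtain ⟨q, hq, hψq⟩ := exists_entire_log hψ hne
  have hre : ∀ z w, (q w + conj z * φ w).re ≤
      ‖w‖ ^ 2 / 2 + ((q z).re + ‖φ z‖ ^ 2 / 2) := by
    intro z w
    have := hineq z w
    rw [hψq, hψq, ← Complex.exp_add, Complex.norm_exp, Complex.norm_exp, ← Real.exp_add,
      ← Real.exp_add, Real.exp_le_exp] at this
    exact this
  -- The choices `z = 0` and `z = 1` control `q` and `q + φ`, hence `φ` by subtraction.
  obtain ⟨a₀, a₁, a₂, ha⟩ := eq_quadratic_of_re_le hq fun w => by simpa using hre 0 w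
  obtain ⟨b₀, b₁, b₂, hb⟩ := eq_quadratic_of_re_le (f := fun w => q w + φ w) (by fun_prop)
    fun w => by simpa using hre 1 w
  have hφ' : ∀ w, φ w = (b₀ - a₀) + (b₁ - a₁) * w + (b₂ - a₂) * w ^ 2 := fun w => by
    linear_combination hb w - ha w
  -- For real `w = t`, the `t²` coefficient forces `Re (a₂ + (b₂ - a₂) z) ≤ 1 / 2` for every `z`.
  have hb₂ : b₂ - a₂ = 0 := by
    refine eq_zero_of_forall_re_mul_le (c := 1 / 2 - a₂.re) fun z => ?_
    rw [← sub_nonpos]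
    refine nonpos_of_quadratic_le (b := (a₁ + z * (b₁ - a₁)).re)
      (c := (q (conj z)).re + ‖φ (conj z)‖ ^ 2 / 2 - (a₀ + z * (b₀ - a₀)).re) fun t => ?_
    have h1 := hre (conj z) t
    rw [Complex.conj_conj, ha t, hφ' t, Complex.norm_real, Real.norm_eq_abs, sq_abs] at h1
    have h2 : a₀ + a₁ * t + a₂ * t ^ 2 +
        z * (b₀ - a₀ + (b₁ - a₁) * t + (b₂ - a₂) * t ^ 2) =
        (a₀ + z * (b₀ - a₀)) + (a₁ + z * (b₁ - a₁)) * (t : ℝ) +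
          (a₂ + (b₂ - a₂) * z) * ((t ^ 2 : ℝ) : ℂ) := by
      push_cast
      ring
    rw [h2, Complex.add_re, Complex.add_re, Complex.re_mul_ofReal, Complex.re_mul_ofReal,
      Complex.add_re a₂] at h1
    linarith
  have hφ'' : ∀ w, φ w = (b₁ - a₁) * w + (b₀ - a₀) := fun w => by
    rw [hφ', hb₂]
    ring
  obtain ⟨ha₂, hrel⟩ := linear_of_kernel_ineq (a₀ := a₀) (a₁ := a₁) (a₂ := a₂)
    (A := b₁ - a₁) (B := b₀ - a₀) fun z w => by
      have := hre z w
      rwa [ha, ha, hφ'', hφ''] at this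
  have hψ' : ∀ z, ψ z = cexp a₀ * cexp (a₁ * z) := fun z => by
    rw [hψq, ha, ha₂, ← Complex.exp_add]
    ring_nf
  refine ⟨b₁ - a₁, b₀ - a₀, cexp a₀, a₁, hφ'', hψ', ?_, hrel⟩
  -- `kernel 0` is the constant 1; its images under `W` and its adjoint have norms `|C| e^{‖D‖²/2}`
  -- and `|C| e^{‖B‖²/2}`.
  obtain ⟨g, hg, hg'⟩ := hn.exists_image_kernel hW 0
  have hgk : g = cexp a₀ • kernel (conj a₁) := Fock.ext fun w => by
    rw [hg, hψ', map_zero, zero_mul, Complex.exp_zero, mul_one]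
    change _ = cexp a₀ * kernel (conj a₁) w
    rw [kernel_apply, Complex.conj_conj]
  rw [hgk, norm_smul, norm_kernel, hψ', hφ'', mul_zero, mul_zero, Complex.exp_zero, mul_one,
    zero_add, RCLike.norm_conj] at hg'
  have h1 := mul_left_cancel₀ (norm_ne_zero_iff.2 (Complex.exp_ne_zero a₀)) hg'
  rw [Real.exp_eq_exp] at h1
  rw [← sq_eq_sq₀ (norm_nonneg _) (norm_nonneg _)]
  linarith

end Normal

/-- A normal operator has no proper normal extension. -/
theorem IsNormal.eq_of_le {H : Type*} [NormedAddCommGroup H] [InnerProductSpace ℂ H]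
    [CompleteSpace H] {S T : H →ₗ.[ℂ] H} (hS : IsNormal S) (hT : IsNormal T) (h : S ≤ T) :
    S = T := by
  refine LinearPMap.eq_of_le_of_domain_eq h (le_antisymm h.1 fun x hx => ?_)
  rw [hT.domain_eq] at hx
  rw [hS.domain_eq]
  -- Adjoints reverse inclusion: `dom T = dom T* ⊆ dom S* = dom S`.
  refine LinearPMap.mem_adjoint_domain_of_exists _ ⟨T.adjoint ⟨x, hx⟩, fun y => ?_⟩
  rw [h.2 (y := ⟨y, h.1 y.2⟩) rfl]
  exact LinearPMap.adjoint_isFormalAdjoint hT.dense_domain ⟨x, hx⟩ ⟨y, h.1 y.2⟩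

end FockWCO

end

theorem theorem6p7 (ψ φ : ℂ → ℂ) (hψ : Differentiable ℂ ψ) (hφ : Differentiable ℂ φ)
    (hψ0 : ∃ z, ψ z ≠ 0) (W : FockWCO.Fock →ₗ.[ℂ] FockWCO.Fock)
    (hW : W ≤ FockWCO.maxWCO ψ φ) :
    FockWCO.IsNormal W ↔
      W = FockWCO.maxWCO ψ φ ∧
        ((∃ A B C D : ℂ, A ≠ 1 ∧ (∀ z, φ z = A * z + B) ∧
            (∀ z, ψ z = C * Complex.exp (D * z)) ∧
            D = starRingEnd ℂ B * (1 - A) * (1 - starRingEnd ℂ A)⁻¹) ∨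
          (∃ B C D : ℂ, (∀ z, φ z = z + B) ∧
            (∀ z, ψ z = C * Complex.exp (D * z)) ∧ ‖D‖ = ‖B‖)) := by
  have hne : ∀ A : ℂ, A ≠ 1 → 1 - conj A ≠ 0 := fun A hA h => by
    rw [sub_eq_zero, eq_comm, map_eq_one_iff _ (starRingEnd ℂ).injective] at h
    exact hA h
  -- Both cases are instances of these two conditions: for `A = 1` the last is vacuous, and for `A ≠
  -- 1` it determines `D` and forces `‖B‖ = ‖D‖`.
  have hmax : ∀ A B C D : ℂ, (∀ z, φ z = A * z + B) → (∀ z, ψ z = C * Complex.exp (D * z)) →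
      ‖B‖ = ‖D‖ → D * (1 - conj A) = conj B * (1 - A) → FockWCO.IsNormal (FockWCO.maxWCO ψ φ) := by
    intro A B C D h1 h2 h3 h4
    rw [show φ = FockWCO.affineSymbol A B from funext h1,
      show ψ = FockWCO.expWeight C D from funext h2]
    exact FockWCO.isNormal_affineWCO h3 h4
  constructor
  · intro hn
    obtain ⟨A, B, C, D, h1, h2, h3, h4⟩ := hn.symbol_form hW hψ hφ hψ0
    refine ⟨hn.eq_of_le (hmax A B C D h1 h2 h3 h4) hW, ?_⟩
    by_cases hA : A = 1
    · subst hA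
      exact Or.inr ⟨B, C, D, by simpa using h1, h2, h3.symm⟩
    · exact Or.inl ⟨A, B, C, D, hA, h1, h2, by rw [← h4, mul_inv_cancel_right₀ (hne A hA)]⟩
  · rintro ⟨rfl, ⟨A, B, C, D, hA, h1, h2, h3⟩ | ⟨B, C, D, h1, h2, h3⟩⟩
    · refine hmax A B C D h1 h2 ?_ ?_
      · have h4 : ‖1 - conj A‖ = ‖1 - A‖ := by
          rw [← RCLike.norm_conj, map_sub, Complex.conj_conj, map_one]
        have h5 : ‖1 - A‖ ≠ 0 := norm_ne_zero_iff.2 (sub_ne_zero.2 (Ne.symm hA))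
        rw [h3, norm_mul, norm_mul, norm_inv, h4, mul_inv_cancel_right₀ h5, RCLike.norm_conj]
      · rw [h3, inv_mul_cancel_right₀ (hne A hA)]
    · exact hmax 1 B C D (by simpa using h1) h2 h3.symm (by simp)
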